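/- Let $\Phi:(0,\infty)\to\mathbb{R}$ be a special Bernstein function, i.e. $\Phi\not\equiv 0$ and both $\Phi$ and $\lambda\mapsto\lambda/\Phi(\lambda)$ are Bernstein functions (smooth, nonnegative, with $(-1)^n\Phi^{(n)}\le 0$ for all $n\ge 1$). Let $(a_\Phi,b_\Phi,\nu_\Phi)$ be its Lévy triplet, $\Phi(\lambda)=a_\Phi+b_\Phi\lambda+\int_0^\infty(1-e^{-\lambda x})\,\nu_\Phi(dx)$ with $\int_0^\infty(1\wedge x)\,\nu_\Phi(dx)<\infty$, and suppose that $a_\Phi=b_\Phi=0$ and $\nu_\Phi(0,\infty)=\infty$. Let $\sigma_\Phi$ be the subordinator with Laplace exponent $\Phi$, that is, the nondecreasing Lévy process with $\mathbb{E}[e^{-\lambda\sigma_\Phi(t)}]=e^{-t\Phi(\lambda)}$, and let $u_\Phi$ be its potential density, i.e. the nonnegative, nonincreasing density on $(0,\infty)$ of the potential measure $U_\Phi(A)=\mathbb{E}\left[\int_0^\infty \mathbf{1}_A(\sigma_\Phi(s))\,ds\right]$. Suppose that there are $t_0>0$, $C>0$ and $\beta\in(0,1)$ with $u_\Phi(t)\le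 Ct^{\beta-1}$ for all $t\in(0,t_0)$. Suppose moreover that $\nu_\Phi$ is absolutely continuous with respect to Lebesgue measure. Let $(X,|\cdot|)$ be a Banach space, $f_0\in X$, and let $F:[0,\infty)\times X\to X$ be such that for every $T>0$ and every ball $B_R=\{x\in X:|x|<R\}$ there is a constant $L>0$ (depending on $T$ and $R$) such that, for almost every $t\in[0,T]$, $|F(t,x)-F(t,z)|\le L|x-z|$ for all $x,z\in B_R$. For $f\in C([0,\infty),X)$ write $G_f(t)=\int_0^t\nu_\Phi(t-s,\infty)\,(f(s)-f(0))\,ds$ (Bochner integral). The generalized Caputo derivative $\partial_t^\Phi f$ is well defined if $G_f$ is absolutely continuous on every bounded interval $[0,T]$ and differentiable at almost every $t>0$; it is then $\partial_t^\Phi f(t)=\frac{d}{dt}G_f(t)$ for a.e. $t$. Then the Cauchy problem $$\partial_t^\Phi f(t)=F(t,f(t))\ \text{ for a.e. } t\in[0,\infty),\qquad f(0)=f_0,$$ has at most one solution $f\in C([0,\infty),X)$ with $\partial_t^\Phi f$ well defined: any two such solutions coincide on $[0,\infty)$. -/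

import Mathlib

open MeasureTheory ProbabilityTheory Set
open scoped NNReal ENNReal

/-- Bernstein functions on `(0,∞)`: smooth, nonnegative, with `(-1)^n Φ^(n) ≤ 0` for all `n ≥ 1`.
Only the values of `Φ` on `(0,∞)` matter. -/
structure IsBernstein (Φ : ℝ → ℝ) : Prop where
  contDiffOn : ContDiffOn ℝ ((⊤ : ℕ∞) : WithTop ℕ∞) Φ (Ioi 0)
  nonneg : ∀ z : ℝ, 0 < z → 0 ≤ Φ z
  sign : ∀ n : ℕ, 1 ≤ n → ∀ z : ℝ, 0 < z → (-1 : ℝ) ^ n * iteratedDeriv n Φ z ≤ 0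

/-- Special Bernstein functions: Bernstein functions whose conjugate `z ↦ z / Φ z` is again a
Bernstein function. The positivity makes the conjugate meaningful; it only excludes `Φ = 0`. -/
structure IsSpecialBernstein (Φ : ℝ → ℝ) : Prop where
  bernstein : IsBernstein Φ
  pos : ∀ z : ℝ, 0 < z → 0 < Φ z
  conjugate : IsBernstein (fun z => z / Φ z)

/-- `(a, b, ν)` is the Lévy triplet of `Φ`; measures on `(0,∞)` are measures on `ℝ` that do not
charge `(-∞,0]`. -/
structure IsLevyTriplet (Φ : ℝ → ℝ) (a b : ℝ) (ν : Measure ℝ) : Prop where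
  a_nonneg : 0 ≤ a
  b_nonneg : 0 ≤ b
  null_Iic : ν (Iic 0) = 0
  lintegral_lt_top : ∫⁻ x in Ioi 0, ENNReal.ofReal (min 1 x) ∂ν < ∞
  eq : ∀ z : ℝ, 0 < z → Φ z = a + b * z + ∫ x in Ioi 0, (1 - Real.exp (-(z * x))) ∂ν

/-- Subordinators: nondecreasing Lévy processes (left limits of the paths exist by monotonicity). -/
structure IsSubordinator {Ω : Type*} [MeasurableSpace Ω] (P : Measure Ω)
    (σ : ℝ≥0 → Ω → ℝ) : Prop where
  measurable : ∀ t, Measurable (σ t)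
  zero : ∀ᵐ ω ∂P, σ 0 ω = 0
  indep_increments : HasIndepIncrements σ P
  stationary_increments : ∀ s t, IdentDistrib (fun ω => σ (s + t) ω - σ s ω) (σ t) P P
  right_continuous : ∀ᵐ ω ∂P, ∀ t, ContinuousWithinAt (fun r => σ r ω) (Ici t) t
  monotone : ∀ᵐ ω ∂P, Monotone (fun t => σ t ω)

/-- `σ` has Laplace exponent `Φ`: `E[exp (-z σ_t)] = exp (-t Φ z)`. -/
def HasLaplaceExponent {Ω : Type*} [MeasurableSpace Ω] (P : Measure Ω)
    (σ : ℝ≥0 → Ω → ℝ) (Φ : ℝ → ℝ) : Prop :=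
  ∀ (t : ℝ≥0) (z : ℝ), 0 < z → ∫ ω, Real.exp (-(z * σ t ω)) ∂P = Real.exp (-(t * Φ z))

/-- The potential (occupation) measure `U(A) = E[∫_0^∞ 1_A(σ_s) ds]`. -/
noncomputable def potentialMeasure {Ω : Type*} [MeasurableSpace Ω] (P : Measure Ω)
    (σ : ℝ≥0 → Ω → ℝ) (A : Set ℝ) : ℝ≥0∞ :=
  ∫⁻ ω, (∫⁻ s in Ici (0 : ℝ), A.indicator (fun _ => (1 : ℝ≥0∞)) (σ s.toNNReal ω)) ∂P

/-- `u` is a potential density of `σ`: a nonnegative, nonincreasing density on `(0,∞)` of the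
potential measure. -/
structure IsPotentialDensity {Ω : Type*} [MeasurableSpace Ω] (P : Measure Ω)
    (σ : ℝ≥0 → Ω → ℝ) (u : ℝ → ℝ) : Prop where
  nonneg : ∀ t : ℝ, 0 < t → 0 ≤ u t
  antitoneOn : AntitoneOn u (Ioi 0)
  eq : ∀ A : Set ℝ, MeasurableSet A →
    potentialMeasure P σ A = ∫⁻ t in A ∩ Ioi 0, ENNReal.ofReal (u t)

/-- The standing assumption on a Bernstein function with Lévy triplet `(a, b, ν)` and
potential density `u`. -/
structure StandingAssumption (Φ : ℝ → ℝ) (a b : ℝ) (ν : Measure ℝ) (u : ℝ → ℝ) : Prop where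
  special : IsSpecialBernstein Φ
  a_eq : a = 0
  b_eq : b = 0
  infinite : ν (Ioi 0) = ∞
  bound : ∃ t₀ C β : ℝ, 0 < t₀ ∧ 0 < C ∧ 0 < β ∧ β < 1 ∧
    ∀ t : ℝ, 0 < t → t < t₀ → u t ≤ C * t ^ (β - 1)

/-- The tail `ν(t,∞)`, finite for `t > 0` when `ν` is a Lévy measure. -/
noncomputable def levyTail (ν : Measure ℝ) (t : ℝ) : ℝ := (ν (Ioi t)).toReal

/-- `t ↦ ∫_0^t ν(t-s,∞) (f(s) - f(0)) ds`. -/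
noncomputable def caputoConv {X : Type*} [NormedAddCommGroup X] [NormedSpace ℝ X]
    (ν : Measure ℝ) (f : ℝ → X) (t : ℝ) : X :=
  ∫ s in (0 : ℝ)..t, levyTail ν (t - s) • (f s - f 0)

/-- The generalized Caputo derivative of `f` is well defined on `[0,∞)` and equals `y t` for
almost every `t > 0`: the convolution above is absolutely continuous on bounded intervals and has
derivative `y t` at almost every `t`. Only the values of `f` on `[0,∞)` matter. -/
structure HasCaputoDeriv {X : Type*} [NormedAddCommGroup X] [NormedSpace ℝ X]
    (ν : Measure ℝ) (f y : ℝ → X) : Prop where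
  absolutelyContinuous : ∀ T : ℝ, 0 < T → AbsolutelyContinuousOnInterval (caputoConv ν f) 0 T
  hasDerivAt : ∀ᵐ t ∂(volume.restrict (Ioi (0 : ℝ))), HasDerivAt (caputoConv ν f) (y t) t

/-- `f` restricted to `[0,∞)` is a solution in `C([0,∞), X)` of the Cauchy problem
`∂^Φ f(t) = F(t, f(t))` for a.e. `t`, `f(0) = f₀`. -/
structure IsGlobalSolution {X : Type*} [NormedAddCommGroup X] [NormedSpace ℝ X]
    (ν : Measure ℝ) (F : ℝ → X → X) (f₀ : X) (f : ℝ → X) : Prop where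
  continuousOn : ContinuousOn f (Ici 0)
  initial : f 0 = f₀
  equation : HasCaputoDeriv ν f (fun t => F t (f t))

/-- Local Lipschitz condition on balls, on every time interval `[0,T]`. -/
def LocLipschitzOnBalls {X : Type*} [NormedAddCommGroup X] (F : ℝ → X → X) : Prop :=
  ∀ T : ℝ, 0 < T → ∀ R : ℝ, 0 < R → ∃ L : ℝ, 0 < L ∧
    ∀ᵐ t ∂(volume.restrict (Icc (0 : ℝ) T)), ∀ x ∈ Metric.ball (0 : X) R,
      ∀ z ∈ Metric.ball (0 : X) R, ‖F t x - F t z‖ ≤ L * ‖x - z‖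

/-!
Write `*` for convolution on the half line, of functions or measures. The difference `h = f - g` of
two solutions, extended by `0`, satisfies `N * h = 1 * y`, where `N` is the measure
`ν(t,∞) dt` on `(0,∞)` and `y` is the difference of the two right-hand sides; on `[0,T]` the
Lipschitz condition gives `‖y‖ ≤ L ‖h‖`. Passing from the Caputo derivative to this integral
equation uses the fundamental theorem of calculus for absolutely continuous, almost everywhere differentiable
functions with values in a Banach space
(`AbsolutelyContinuousOnInterval.eq_integral_of_ae_hasDerivAt`).

Let `U` be the potential measure of the subordinator. The Laplace transforms of `U` and `N` are
`1 / Φ z` (`exists_measure_eq_potentialMeasure`) and `Φ z / z` (`laplace_tailMeasure`), with product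
`1 / z`; by uniqueness of Laplace transforms (`ext_of_laplace_eq`), `U * N` is Lebesgue measure on
`(0,∞)` (`conv_tailMeasure_eq_volume`). Convolving the equation for `h` with `U` therefore yields
`1 * h = 1 * (U * y)` (`integral_eq_integral_conv`), that is, `h = U * y`
almost everywhere, and `‖h‖ ≤ L U * ‖h‖`.

Because `U` does not charge `(-∞,0]`, its Laplace transform vanishes at infinity. For large `k` the
right-hand side is thus a strict contraction in the norm `sup exp (-k s) ‖h s‖` over `[0,T]`, so
`h = 0` (`eq_zero_of_integral_conv_eq`).
-/

/-! ### Laplace transforms of measures on the line -/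

/-- The (two-sided) Laplace transform `z ↦ ∫ exp (-z x) κ(dx)` of a measure, with values
in `[0,∞]`. -/
noncomputable def laplace (κ : Measure ℝ) (z : ℝ) : ℝ≥0∞ :=
  ∫⁻ x, ENNReal.ofReal (Real.exp (-(z * x))) ∂κ

/-- The exponentially tilted measure `exp (-x) κ(dx)`; it is finite when `laplace κ 1 < ∞`. -/
noncomputable def expTilt (κ : Measure ℝ) : Measure ℝ :=
  κ.withDensity fun x => ENNReal.ofReal (Real.exp (-x))

lemma laplace_expTilt (κ : Measure ℝ) (z : ℝ) : laplace (expTilt κ) z = laplace κ (z + 1) := by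
  unfold laplace expTilt
  rw [lintegral_withDensity_eq_lintegral_mul _ (by fun_prop) (by fun_prop)]
  refine lintegral_congr fun x => ?_
  simp only [Pi.mul_apply]
  rw [← ENNReal.ofReal_mul (Real.exp_pos _).le, ← Real.exp_add]
  ring_nf

lemma expTilt_injective : Function.Injective expTilt := by
  have key (κ : Measure ℝ) :
      (expTilt κ).withDensity (fun x => ENNReal.ofReal (Real.exp x)) = κ := by
    unfold expTilt
    rw [← withDensity_mul _ (by fun_prop) (by fun_prop)]
    convert withDensity_one (μ := κ) using 2
    ext x
    simp [← ENNReal.ofReal_mul (Real.exp_pos _).le, ← Real.exp_add]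
  intro κ₁ κ₂ h
  rw [← key κ₁, ← key κ₂, h]

lemma integrable_exp_of_laplace_ne_top {κ : Measure ℝ} {z : ℝ} (h : laplace κ z ≠ ∞) :
    Integrable (fun x => Real.exp (-(z * x))) κ := by
  refine ⟨by fun_prop, ?_⟩
  rw [hasFiniteIntegral_iff_ofReal (ae_of_all _ fun x => (Real.exp_pos _).le)]
  exact h.lt_top

/-- Finite Laplace transforms on `(0,∞)` determine the measure: after an exponential tilt, the
complex moment generating functions are analytic on the half plane `re w < 1`, agree on its real
points, hence also on the imaginary axis, where they are the characteristic functions. -/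
theorem ext_of_laplace_eq {κ₁ κ₂ : Measure ℝ} (h : ∀ z, 0 < z → laplace κ₁ z = laplace κ₂ z)
    (hfin : ∀ z, 0 < z → laplace κ₁ z ≠ ∞) : κ₁ = κ₂ := by
  apply expTilt_injective
  have hfin₁ (z : ℝ) (hz : -1 < z) : laplace (expTilt κ₁) z ≠ ∞ := by
    rw [laplace_expTilt]; exact hfin _ (by linarith)
  have heq (z : ℝ) (hz : -1 < z) : laplace (expTilt κ₁) z = laplace (expTilt κ₂) z := by
    rw [laplace_expTilt, laplace_expTilt]; exact h _ (by linarith)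
  have hfin₂ (z : ℝ) (hz : -1 < z) : laplace (expTilt κ₂) z ≠ ∞ := heq z hz ▸ hfin₁ z hz
  have hfinite {κ : Measure ℝ} (hκ : ∀ z, -1 < z → laplace κ z ≠ ∞) : IsFiniteMeasure κ :=
    ⟨by simpa [laplace] using (hκ 0 (by norm_num)).lt_top⟩
  have hset {κ : Measure ℝ} (hκ : ∀ z, -1 < z → laplace κ z ≠ ∞) :
      Iio 1 ⊆ interior (integrableExpSet id κ) := by
    refine interior_maximal (fun s hs => ?_) isOpen_Iio
    simpa [integrableExpSet] using
      integrable_exp_of_laplace_ne_top (hκ (-s) (neg_lt_neg (mem_Iio.1 hs)))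
  have hmgf (s : ℝ) (hs : s < 1) : mgf id (expTilt κ₁) s = mgf id (expTilt κ₂) s := by
    have key (κ : Measure ℝ) : mgf id κ s = (laplace κ (-s)).toReal := by
      rw [mgf, laplace, integral_eq_lintegral_of_nonneg_ae
        (ae_of_all _ fun x => (Real.exp_pos _).le) (by fun_prop)]
      simp
    rw [key, key, heq _ (by linarith)]
  have := hfinite hfin₁
  have := hfinite hfin₂
  have hana {κ : Measure ℝ} (hκ : ∀ z, -1 < z → laplace κ z ≠ ∞) :
      AnalyticOnNhd ℂ (complexMGF id κ) {w | w.re < 1} :=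
    analyticOnNhd_complexMGF.mono fun w hw => hset hκ hw
  have hEq : EqOn (complexMGF id (expTilt κ₁)) (complexMGF id (expTilt κ₂)) {w | w.re < 1} := by
    refine AnalyticOnNhd.eqOn_of_preconnected_of_frequently_eq (hana hfin₁) (hana hfin₂)
      (convex_halfSpace_re_lt 1).isPreconnected (z₀ := 0) (by simp) ?_
    have hseq : Filter.Tendsto (fun n : ℕ => (((-1 / ((n : ℝ) + 1) : ℝ)) : ℂ)) Filter.atTop
        (nhdsWithin 0 {0}ᶜ) := by
      rw [tendsto_nhdsWithin_iff]
      constructor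
      · rw [← Complex.ofReal_zero]
        refine (Complex.continuous_ofReal.tendsto 0).comp ?_
        simpa [neg_div] using (tendsto_one_div_add_atTop_nhds_zero_nat (𝕜 := ℝ)).neg
      · refine Filter.Eventually.of_forall fun n => ?_
        simp only [mem_compl_iff, mem_singleton_iff, Complex.ofReal_eq_zero]
        have : (0 : ℝ) < (n : ℝ) + 1 := by positivity
        simp [this.ne']
    refine hseq.frequently (Filter.Frequently.of_forall fun n => ?_)
    rw [complexMGF_ofReal, complexMGF_ofReal, hmgf]
    have : (-1 : ℝ) / ((n : ℝ) + 1) ≤ 0 :=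
      div_nonpos_of_nonpos_of_nonneg (by norm_num) (by positivity)
    linarith
  refine Measure.ext_of_charFun (funext fun t => ?_)
  rw [← complexMGF_id_mul_I, ← complexMGF_id_mul_I]
  exact hEq (by simp)

lemma laplace_volume_Ioi {z : ℝ} (hz : 0 < z) :
    laplace (volume.restrict (Ioi 0)) z = ENNReal.ofReal (1 / z) := by
  have h := integral_exp_mul_Ioi (a := -z) (by linarith) 0
  have hint : IntegrableOn (fun x : ℝ => Real.exp (-z * x)) (Ioi 0) := exp_neg_integrableOn_Ioi 0 hz
  rw [laplace]
  simp only [← neg_mul]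
  rw [← ofReal_integral_eq_lintegral_ofReal hint (ae_of_all _ fun x => (Real.exp_pos _).le), h]
  simp

lemma laplace_conv (κ₁ κ₂ : Measure ℝ) [SFinite κ₁] [SFinite κ₂] (z : ℝ) :
    laplace (κ₁ ∗ κ₂) z = laplace κ₁ z * laplace κ₂ z := by
  unfold laplace
  rw [Measure.lintegral_conv (by fun_prop)]
  simp_rw [mul_add, neg_add, Real.exp_add, ENNReal.ofReal_mul (Real.exp_pos _).le]
  have hm : Measurable fun x : ℝ => ENNReal.ofReal (Real.exp (-(z * x))) := by fun_prop
  simp_rw [lintegral_const_mul _ hm]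
  rw [lintegral_mul_const _ (by fun_prop)]

/-- A measure with a finite Laplace transform at `1` is finite on left half lines. -/
lemma measure_Iic_ne_top_of_laplace {κ : Measure ℝ} (h : laplace κ 1 ≠ ∞) (T : ℝ) :
    κ (Iic T) ≠ ∞ := by
  have hle : ENNReal.ofReal (Real.exp (-T)) * κ (Iic T) ≤ laplace κ 1 := by
    rw [← setLIntegral_const]
    refine le_trans (setLIntegral_mono (by fun_prop) fun x hx => ?_) (setLIntegral_le_lintegral _ _)
    exact ENNReal.ofReal_le_ofReal (Real.exp_le_exp.2 (by linarith [mem_Iic.1 hx]))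
  intro htop
  rw [htop, ENNReal.mul_top (by simpa using Real.exp_pos _), top_le_iff] at hle
  exact h hle

lemma ae_pos_of_measure_Iic_zero {κ : Measure ℝ} (h0 : κ (Iic 0) = 0) : ∀ᵐ x ∂κ, 0 < x := by
  rw [ae_iff]; simpa [Iic_def] using h0

/-- The Laplace transform of a measure on `(0,∞)` vanishes at infinity, along the integers. -/
lemma tendsto_laplace_atTop {κ : Measure ℝ} (h : laplace κ 1 ≠ ∞) (h0 : κ (Iic 0) = 0) :
    Filter.Tendsto (fun n : ℕ => laplace κ (n + 1)) Filter.atTop (nhds 0) := by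
  have hpos := ae_pos_of_measure_Iic_zero h0
  have := tendsto_lintegral_of_dominated_convergence (μ := κ)
    (F := fun (n : ℕ) x => ENNReal.ofReal (Real.exp (-(((n : ℝ) + 1) * x)))) (f := fun _ => 0)
    (fun x => ENNReal.ofReal (Real.exp (-(1 * x)))) (fun n => by fun_prop) ?_ h ?_
  · simpa [laplace] using this
  · intro n
    filter_upwards [hpos] with x hx
    refine ENNReal.ofReal_le_ofReal (Real.exp_le_exp.2 ?_)
    have : 0 ≤ (n : ℝ) * x := by positivity
    linarith
  · filter_upwards [hpos] with x hx
    rw [← ENNReal.ofReal_zero]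
    refine ENNReal.tendsto_ofReal (Real.tendsto_exp_neg_atTop_nhds_zero.comp ?_)
    exact (tendsto_natCast_atTop_atTop.atTop_add tendsto_const_nhds).atTop_mul_const hx

/-! ### The tail of the Lévy measure and the potential measure -/

/-- The measure `ν(t,∞) dt` on `(0,∞)`. -/
noncomputable def tailMeasure (ν : Measure ℝ) : Measure ℝ :=
  (volume.restrict (Ioi 0)).withDensity fun t => ν (Ioi t)

lemma measurable_measure_Ioi (ν : Measure ℝ) : Measurable fun t => ν (Ioi t) :=
  Antitone.measurable fun _ _ h => measure_mono (Ioi_subset_Ioi h)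

instance (ν : Measure ℝ) : SFinite (tailMeasure ν) := by unfold tailMeasure; infer_instance

lemma laplace_tailMeasure_eq_setLIntegral (ν : Measure ℝ) (z : ℝ) :
    laplace (tailMeasure ν) z =
      ∫⁻ t in Ioi 0, ν (Ioi t) * ENNReal.ofReal (Real.exp (-(z * t))) := by
  rw [laplace, tailMeasure,
    lintegral_withDensity_eq_lintegral_mul _ (measurable_measure_Ioi ν) (by fun_prop)]
  rfl

lemma tailMeasure_Iic_zero (ν : Measure ℝ) : tailMeasure ν (Iic 0) = 0 := by
  refine withDensity_absolutelyContinuous _ _ ?_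
  rw [Measure.restrict_apply measurableSet_Iic, Iic_inter_Ioi, Ioc_self, measure_empty]

/-- Without killing and drift the tail measure has Laplace transform `Φ z / z`, by the layer cake
formula applied to `1 - exp (-z x) = z ∫_0^x exp (-z t) dt`. -/
lemma laplace_tailMeasure {Φ : ℝ → ℝ} {ν : Measure ℝ} (hν : IsLevyTriplet Φ 0 0 ν)
    (hpos : ∀ z, 0 < z → 0 < Φ z) {z : ℝ} (hz : 0 < z) :
    laplace (tailMeasure ν) z = ENNReal.ofReal (Φ z / z) := by
  have hν0 := ae_pos_of_measure_Iic_zero hν.null_Iic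
  have hΦ : Φ z = ∫ x in Ioi 0, (1 - Real.exp (-(z * x))) ∂ν := by
    simpa using hν.eq z hz
  -- A non-integrable integrand would give the value `0`, which positivity of `Φ` excludes.
  have hint : Integrable (fun x => 1 - Real.exp (-(z * x))) (ν.restrict (Ioi 0)) := by
    by_contra hcon
    rw [integral_undef hcon] at hΦ
    exact (hpos z hz).ne' hΦ
  have hr : ν.restrict (Ioi 0) = ν := Measure.restrict_eq_self_of_ae_mem hν0
  rw [hr] at hint hΦ
  have hcake := lintegral_comp_eq_lintegral_meas_lt_mul ν (f := fun x => x)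
    (g := fun t => Real.exp (-(z * t))) (hν0.mono fun x hx => hx.le) (by fun_prop)
    (fun t _ => Continuous.intervalIntegrable (by fun_prop) _ _)
    (ae_of_all _ fun t => (Real.exp_pos _).le)
  have hprim (x : ℝ) : ∫ t in (0 : ℝ)..x, Real.exp (-(z * t)) = (1 - Real.exp (-(z * x))) / z := by
    have hd (t : ℝ) : HasDerivAt (fun t => -(Real.exp (-(z * t)) / z)) (Real.exp (-(z * t))) t := by
      have := (((((hasDerivAt_id t).const_mul z).neg).exp).div_const z).neg
      refine this.congr_deriv ?_
      simp only [Pi.neg_apply, id_eq, mul_one]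
      field_simp
    rw [intervalIntegral.integral_eq_sub_of_hasDerivAt (fun t _ => hd t)
      (Continuous.intervalIntegrable (by fun_prop) _ _)]
    simp
    ring
  simp_rw [hprim] at hcake
  rw [laplace_tailMeasure_eq_setLIntegral]
  change _ = ∫⁻ t in Ioi 0, ν (Ioi t) * _ at hcake
  rw [← hcake, ← ofReal_integral_eq_lintegral_ofReal (hint.div_const z), integral_div, hΦ]
  filter_upwards [hν0] with x hx
  have : Real.exp (-(z * x)) ≤ 1 := Real.exp_le_one_iff.2 (by nlinarith)
  exact div_nonneg (by linarith) hz.le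

lemma ae_measure_Ioi_lt_top {ν : Measure ℝ} (h : laplace (tailMeasure ν) 1 ≠ ∞) :
    ∀ᵐ t ∂volume.restrict (Ioi 0), ν (Ioi t) < ∞ := by
  rw [laplace_tailMeasure_eq_setLIntegral] at h
  have hm : Measurable fun t => ν (Ioi t) * ENNReal.ofReal (Real.exp (-(1 * t))) :=
    (measurable_measure_Ioi ν).mul (by fun_prop)
  filter_upwards [ae_lt_top hm h] with t ht
  exact lt_of_not_ge fun htop => by
    rw [top_le_iff.1 htop, ENNReal.top_mul (by simpa using Real.exp_pos _)] at ht
    exact lt_irrefl _ ht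

/-- A right-continuous process with measurable marginals is jointly measurable: it is the limit of
its discretizations from the right. -/
lemma measurable_uncurry_of_rightContinuous {Ω : Type*} [MeasurableSpace Ω] {X : ℝ≥0 → Ω → ℝ}
    (hm : ∀ t, Measurable (X t))
    (hc : ∀ ω t, ContinuousWithinAt (fun r => X r ω) (Ici t) t) :
    Measurable (fun p : ℝ≥0 × Ω => X p.1 p.2) := by
  -- With `m = n + 1`, the point `(⌊m t⌋ + 1) / m` lies to the right of `t`, at most `1 / m` away.
  let d (n : ℕ) (t : ℝ≥0) : ℝ≥0 := ((⌊((n : ℝ≥0) + 1) * t⌋₊ : ℝ≥0) + 1) / ((n : ℝ≥0) + 1)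
  have hd_ge (n : ℕ) (t : ℝ≥0) : t ≤ d n t := by
    rw [le_div_iff₀ (by positivity), mul_comm]
    exact (Nat.lt_floor_add_one _).le
  have hd_le (n : ℕ) (t : ℝ≥0) : d n t ≤ t + 1 / ((n : ℝ≥0) + 1) := by
    have h : (⌊((n : ℝ≥0) + 1) * t⌋₊ : ℝ≥0) ≤ ((n : ℝ≥0) + 1) * t := Nat.floor_le (by positivity)
    have h' : t + 1 / ((n : ℝ≥0) + 1) = (((n : ℝ≥0) + 1) * t + 1) / ((n : ℝ≥0) + 1) := by
      field_simp
    rw [h']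
    exact div_le_div_of_nonneg_right (add_le_add_left h 1) (by positivity)
  have hd (t : ℝ≥0) : Filter.Tendsto (fun n => d n t) Filter.atTop (nhdsWithin t (Ici t)) := by
    rw [tendsto_nhdsWithin_iff]
    refine ⟨?_, Filter.Eventually.of_forall fun n => hd_ge n t⟩
    refine tendsto_of_tendsto_of_tendsto_of_le_of_le tendsto_const_nhds ?_
      (fun n => hd_ge n t) (fun n => hd_le n t)
    simpa using (tendsto_one_div_add_atTop_nhds_zero_nat (𝕜 := ℝ≥0)).const_add t
  refine measurable_of_tendsto_metrizable (f := fun n (p : ℝ≥0 × Ω) => X (d n p.1) p.2) ?_ ?_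
  · intro n
    have h : Measurable fun q : ℕ × Ω => X (((q.1 : ℝ≥0) + 1) / ((n : ℝ≥0) + 1)) q.2 :=
      measurable_from_prod_countable_right fun k => hm (((k : ℝ≥0) + 1) / ((n : ℝ≥0) + 1))
    have hfl : Measurable fun p : ℝ≥0 × Ω => ((⌊((n : ℝ≥0) + 1) * p.1⌋₊, p.2) : ℕ × Ω) :=
      (Nat.measurable_floor.comp (by fun_prop)).prodMk measurable_snd
    have := h.comp hfl
    simpa only [d, Function.comp_def] using this
  · rw [tendsto_pi_nhds]
    intro p
    exact (hc p.2 p.1).tendsto.comp (hd p.1)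

/-- The potential measure of a subordinator is the restriction to measurable sets of an s-finite
measure with Laplace transform `1 / Φ`. -/
theorem exists_measure_eq_potentialMeasure {Ω : Type*} [MeasurableSpace Ω] {P : Measure Ω}
    [IsProbabilityMeasure P] {σ : ℝ≥0 → Ω → ℝ} {Φ : ℝ → ℝ} (hσ : IsSubordinator P σ)
    (hσΦ : HasLaplaceExponent P σ Φ) (hpos : ∀ z, 0 < z → 0 < Φ z) :
    ∃ U : Measure ℝ, SFinite U ∧ (∀ A, MeasurableSet A → U A = potentialMeasure P σ A) ∧
      ∀ z, 0 < z → laplace U z = ENNReal.ofReal (1 / Φ z) := by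
  obtain ⟨S, hS, hSm, hSc⟩ := hσ.right_continuous.exists_measurable_mem
  -- On a null set of paths the process is replaced by `0`, which makes it jointly measurable.
  let X (t : ℝ≥0) (ω : Ω) : ℝ := S.indicator (σ t) ω
  have hXσ : ∀ᵐ ω ∂P, ∀ t, X t ω = σ t ω := by
    filter_upwards [hS] with ω hω t using indicator_of_mem hω _
  have hXm : Measurable fun p : ℝ × Ω => X p.1.toNNReal p.2 := by
    have h : Measurable fun p : ℝ≥0 × Ω => X p.1 p.2 := by
      refine measurable_uncurry_of_rightContinuous (fun t => (hσ.measurable t).indicator hSm) ?_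
      intro ω t
      by_cases hω : ω ∈ S
      · simpa [X, hω] using hSc ω hω t
      · simpa [X, hω] using continuousWithinAt_const
    exact h.comp (measurable_fst.real_toNNReal.prodMk measurable_snd)
  let Y (p : ℝ × Ω) : ℝ := X p.1.toNNReal p.2
  refine ⟨((volume.restrict (Ici 0)).prod P).map Y, inferInstance,
    fun A hA => ?_, fun z hz => ?_⟩
  · have hind : Measurable (A.indicator fun _ : ℝ => (1 : ℝ≥0∞)) := measurable_const.indicator hA
    rw [← lintegral_indicator_one hA, potentialMeasure]
    change ∫⁻ x, A.indicator (fun _ => (1 : ℝ≥0∞)) x ∂_ = _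
    rw [lintegral_map hind hXm, lintegral_prod_symm (fun p => A.indicator _ (Y p))
      (hind.comp hXm).aemeasurable]
    refine lintegral_congr_ae ?_
    filter_upwards [hXσ] with ω hω
    simp only [Y, hω]
  · have hexp : Measurable fun x : ℝ => ENNReal.ofReal (Real.exp (-(z * x))) := by fun_prop
    rw [laplace, lintegral_map hexp hXm, lintegral_prod
      (fun p => ENNReal.ofReal (Real.exp (-(z * Y p)))) (hexp.comp hXm).aemeasurable,
      ← laplace_volume_Ioi (hpos z hz), laplace, restrict_Ioi_eq_restrict_Ici]
    refine setLIntegral_congr_fun measurableSet_Ici fun s hs => ?_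
    have hE := hσΦ s.toNNReal z hz
    rw [Real.coe_toNNReal s hs] at hE
    have hint : Integrable (fun ω => Real.exp (-(z * σ s.toNNReal ω))) P := by
      by_contra hcon
      rw [integral_undef hcon] at hE
      exact (Real.exp_pos _).ne hE
    rw [mul_comm (Φ z) s, ← hE, ofReal_integral_eq_lintegral_ofReal hint
      (ae_of_all _ fun ω => (Real.exp_pos _).le)]
    refine lintegral_congr_ae ?_
    filter_upwards [hXσ] with ω hω
    simp only [Y, hω]

/-- The potential measure of a set of non-positive numbers vanishes when there is a potential
density on `(0,∞)`. -/
lemma IsPotentialDensity.potentialMeasure_Iic_zero {Ω : Type*} [MeasurableSpace Ω] {P : Measure Ω}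
    {σ : ℝ≥0 → Ω → ℝ} {u : ℝ → ℝ} (hu : IsPotentialDensity P σ u) :
    potentialMeasure P σ (Iic 0) = 0 := by
  rw [hu.eq _ measurableSet_Iic, Iic_inter_Ioi, Ioc_self]
  simp

/-- The Sonine identity: the potential measure and the tail measure of the Lévy measure convolve to
Lebesgue measure on `(0,∞)`, since `1 / Φ z * (Φ z / z) = 1 / z`. -/
theorem conv_tailMeasure_eq_volume {Φ : ℝ → ℝ} {U ν : Measure ℝ} [SFinite U]
    (hν : IsLevyTriplet Φ 0 0 ν) (hpos : ∀ z, 0 < z → 0 < Φ z)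
    (hU : ∀ z, 0 < z → laplace U z = ENNReal.ofReal (1 / Φ z)) :
    U ∗ tailMeasure ν = volume.restrict (Ioi 0) := by
  have h (z : ℝ) (hz : 0 < z) : laplace (U ∗ tailMeasure ν) z = ENNReal.ofReal (1 / z) := by
    have := hpos z hz
    rw [laplace_conv, hU z hz, laplace_tailMeasure hν hpos hz, ← ENNReal.ofReal_mul (by positivity)]
    congr 1
    field_simp
  refine ext_of_laplace_eq (fun z hz => ?_) (fun z hz => ?_)
  · rw [h z hz, laplace_volume_Ioi hz]
  · rw [h z hz]
    exact ENNReal.ofReal_ne_top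

/-! ### Convolutions of functions supported on the half line -/

section HalfLine

variable {E : Type*} [NormedAddCommGroup E]

lemma integrable_comp_sub_left_of_bounded {κ : Measure ℝ} (h0 : κ (Iic 0) = 0) {t : ℝ}
    (hκ : κ (Iic t) ≠ ∞) {φ : ℝ → E} (hm : StronglyMeasurable φ) (hφ : ∀ s ≤ 0, φ s = 0)
    {C : ℝ} (hC : ∀ s ≤ t, ‖φ s‖ ≤ C) : Integrable (fun x => φ (t - x)) κ := by
  have hind : Integrable ((Iic t).indicator fun _ => C) κ :=
    (integrable_indicator_iff measurableSet_Iic).2 (integrableOn_const hκ)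
  refine hind.mono' (hm.comp_measurable (by fun_prop)).aestronglyMeasurable ?_
  filter_upwards [ae_pos_of_measure_Iic_zero h0] with x hx
  by_cases hxt : x ≤ t
  · rw [indicator_of_mem (mem_Iic.2 hxt)]
    exact hC _ (by linarith)
  · rw [indicator_of_notMem (by simpa using hxt), hφ _ (by linarith), norm_zero]

lemma conv_Iic_zero {κ₁ κ₂ : Measure ℝ} [SFinite κ₂] (h₁ : κ₁ (Iic 0) = 0) (h₂ : κ₂ (Iic 0) = 0) :
    (κ₁ ∗ κ₂) (Iic 0) = 0 := by
  have hm : Measurable ((Iic (0 : ℝ)).indicator fun _ => (1 : ℝ≥0∞)) :=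
    measurable_const.indicator measurableSet_Iic
  rw [← lintegral_indicator_one measurableSet_Iic]
  change ∫⁻ x, (Iic (0 : ℝ)).indicator (fun _ => (1 : ℝ≥0∞)) x ∂_ = _
  rw [Measure.lintegral_conv hm, ← lintegral_zero (μ := κ₁)]
  refine lintegral_congr_ae ?_
  filter_upwards [ae_pos_of_measure_Iic_zero h₁] with x hx
  rw [← lintegral_zero (μ := κ₂)]
  refine lintegral_congr_ae ?_
  filter_upwards [ae_pos_of_measure_Iic_zero h₂] with y hy
  exact indicator_of_notMem (by simpa using add_pos hx hy) _

/-- A continuous function that vanishes on `(-∞,0]` is bounded on left half lines. -/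
lemma exists_bound_of_continuous_of_eq_zero {φ : ℝ → E} (hc : Continuous φ)
    (hφ : ∀ s ≤ 0, φ s = 0) (t : ℝ) : ∃ C, 0 ≤ C ∧ ∀ s ≤ t, ‖φ s‖ ≤ C := by
  obtain ⟨C, hC⟩ := (isCompact_Icc (a := 0) (b := t)).exists_bound_of_continuousOn hc.continuousOn
  refine ⟨max C 0, le_max_right _ _, fun s hs => ?_⟩
  rcases le_total s 0 with h | h
  · rw [hφ s h, norm_zero]; exact le_max_right _ _
  · exact (hC s ⟨h, hs⟩).trans (le_max_left _ _)

variable [NormedSpace ℝ E]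

lemma integral_comp_sub_left_of_nonpos {κ : Measure ℝ} (h0 : κ (Iic 0) = 0) {φ : ℝ → E}
    (hφ : ∀ s ≤ 0, φ s = 0) {t : ℝ} (ht : t ≤ 0) : ∫ x, φ (t - x) ∂κ = 0 := by
  refine integral_eq_zero_of_ae ?_
  filter_upwards [ae_pos_of_measure_Iic_zero h0] with x hx using hφ _ (by linarith)

lemma setIntegral_Ioi_smul_comp_sub {φ : ℝ → E} (hφ : ∀ s ≤ 0, φ s = 0) (c : ℝ → ℝ)
    {t : ℝ} (ht : 0 ≤ t) :
    ∫ x in Ioi 0, c x • φ (t - x) = ∫ s in (0 : ℝ)..t, c (t - s) • φ s := by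
  have h := intervalIntegral.integral_comp_sub_left (a := 0) (b := t)
    (fun s => c (t - s) • φ s) t
  simp only [sub_sub_cancel, sub_self, sub_zero] at h
  rw [← h, intervalIntegral.integral_of_le ht]
  refine setIntegral_eq_of_subset_of_forall_sdiff_eq_zero measurableSet_Ioi Ioc_subset_Ioi_self ?_
  rintro x ⟨hx, hxt⟩
  have : t < x := by simpa [mem_Ioi.1 hx] using hxt
  rw [hφ _ (by linarith), smul_zero]

lemma setIntegral_Ioi_comp_sub {φ : ℝ → E} (hφ : ∀ s ≤ 0, φ s = 0) {t : ℝ} (ht : 0 ≤ t) :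
    ∫ x in Ioi 0, φ (t - x) = ∫ s in (0 : ℝ)..t, φ s := by
  simpa using setIntegral_Ioi_smul_comp_sub hφ (fun _ => 1) ht

/-! ### The Volterra inequality -/

/-- If `U` and `N` convolve to Lebesgue measure, then `N * h = 1 * y` gives `1 * h = 1 * (U * y)`,
by associativity. -/
lemma integral_eq_integral_conv {U N : Measure ℝ} [SFinite U] [SFinite N]
    (hU0 : U (Iic 0) = 0) (hU : laplace U 1 ≠ ∞) (hN0 : N (Iic 0) = 0)
    (hUN : U ∗ N = volume.restrict (Ioi 0)) {h y : ℝ → E} (hc : Continuous h)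
    (hh : ∀ s ≤ 0, h s = 0) (hy : StronglyMeasurable y) {L : ℝ} (hL : 0 ≤ L)
    (hyh : ∀ s, ‖y s‖ ≤ L * ‖h s‖) {T : ℝ}
    (heq : ∀ t ∈ Icc 0 T, ∫ x, h (t - x) ∂N = ∫ s in (0 : ℝ)..t, y s)
    {t : ℝ} (ht : t ∈ Icc 0 T) :
    ∫ s in (0 : ℝ)..t, h s = ∫ s in (0 : ℝ)..t, ∫ x, y (s - x) ∂U := by
  have hy0 (s : ℝ) (hs : s ≤ 0) : y s = 0 := by
    simpa [hh s hs] using hyh s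
  obtain ⟨C, -, hC⟩ := exists_bound_of_continuous_of_eq_zero hc hh t
  have hyC (s : ℝ) (hs : s ≤ t) : ‖y s‖ ≤ L * C :=
    (hyh s).trans (mul_le_mul_of_nonneg_left (hC s hs) hL)
  have hV0 : (volume.restrict (Ioi (0 : ℝ))) (Iic 0) = 0 := by
    rw [Measure.restrict_apply measurableSet_Iic, Iic_inter_Ioi, Ioc_self, measure_empty]
  have hV : laplace (volume.restrict (Ioi 0)) 1 ≠ ∞ := by
    rw [laplace_volume_Ioi one_pos]; exact ENNReal.ofReal_ne_top
  have hUV : laplace (U ∗ volume.restrict (Ioi 0)) 1 ≠ ∞ := by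
    rw [laplace_conv]; exact ENNReal.mul_ne_top hU hV
  have hint_h : Integrable (fun x => h (t - x)) (U ∗ N) := by
    rw [hUN]
    exact integrable_comp_sub_left_of_bounded hV0 (measure_Iic_ne_top_of_laplace hV t)
      hc.stronglyMeasurable hh hC
  have hint_y : Integrable (fun x => y (t - x)) (U ∗ volume.restrict (Ioi 0)) :=
    integrable_comp_sub_left_of_bounded (conv_Iic_zero hU0 hV0)
      (measure_Iic_ne_top_of_laplace hUV t) hy hy0 hyC
  calc ∫ s in (0 : ℝ)..t, h s
      = ∫ x, h (t - x) ∂(U ∗ N) := by rw [hUN, setIntegral_Ioi_comp_sub hh ht.1]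
    _ = ∫ x, ∫ x', h (t - (x + x')) ∂N ∂U := integral_conv hint_h
    _ = ∫ x, ∫ x', y (t - (x + x')) ∂volume.restrict (Ioi 0) ∂U := by
        refine integral_congr_ae ?_
        filter_upwards [ae_pos_of_measure_Iic_zero hU0] with x hx
        simp_rw [← sub_sub]
        rcases le_total (t - x) 0 with hneg | hnonneg
        · rw [integral_comp_sub_left_of_nonpos hN0 hh hneg,
            integral_comp_sub_left_of_nonpos hV0 hy0 hneg]
        · rw [heq _ ⟨hnonneg, by linarith [ht.2]⟩, setIntegral_Ioi_comp_sub hy0 hnonneg]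
    _ = ∫ x, y (t - x) ∂(volume.restrict (Ioi 0) ∗ U) := by
        rw [← integral_conv hint_y, Measure.conv_comm]
    _ = ∫ x in Ioi 0, ∫ x', y (t - x - x') ∂U := by
        rw [Measure.conv_comm] at hint_y
        simp_rw [integral_conv hint_y, sub_sub]
    _ = ∫ s in (0 : ℝ)..t, ∫ x, y (s - x) ∂U :=
        setIntegral_Ioi_comp_sub
          (fun s hs => integral_comp_sub_left_of_nonpos hU0 hy0 hs) ht.1

/-- A continuous function is bounded at `s` by any bound for its averages over `[r, s]`, `r < s`. -/
lemma norm_le_of_norm_integral_le [CompleteSpace E] {h : ℝ → E} (hc : Continuous h) {s K : ℝ}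
    (hs : 0 < s) (hK : ∀ r ∈ Ioo 0 s, ‖∫ x in r..s, h x‖ ≤ K * (s - r)) : ‖h s‖ ≤ K := by
  have hd : HasDerivAt (fun r => ∫ x in s..r, h x) (h s) s :=
    intervalIntegral.integral_hasDerivAt_right (hc.intervalIntegrable _ _)
      hc.stronglyMeasurable.stronglyMeasurableAtFilter hc.continuousAt
  have hslope := (hasDerivWithinAt_iff_tendsto_slope' (s := Iio s) (by simp)).1 hd.hasDerivWithinAt
  refine le_of_tendsto hslope.norm ?_
  filter_upwards [Ioo_mem_nhdsLT hs] with r hr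
  have hpos : 0 < s - r := sub_pos.2 hr.2
  rw [slope_def_module, intervalIntegral.integral_same, sub_zero, norm_smul, norm_inv,
    Real.norm_eq_abs, abs_sub_comm, abs_of_pos hpos, intervalIntegral.integral_symm, norm_neg,
    inv_mul_le_iff₀ hpos, mul_comm]
  exact hK r hr

/-- Uniqueness for the Volterra inequality. In the norm `sup exp (-k s) ‖h s‖` on `[0,T]` the
operator `U *` has norm at most the Laplace transform of `U` at `k`, which is less than `1 / L`
for large `k`. -/
theorem eq_zero_of_integral_conv_eq [CompleteSpace E] {U N : Measure ℝ} [SFinite U] [SFinite N]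
    (hU0 : U (Iic 0) = 0) (hU : ∀ z, 0 < z → laplace U z ≠ ∞) (hN0 : N (Iic 0) = 0)
    (hUN : U ∗ N = volume.restrict (Ioi 0)) {h y : ℝ → E} (hc : Continuous h)
    (hh : ∀ s ≤ 0, h s = 0) (hy : StronglyMeasurable y) {L : ℝ} (hL : 0 ≤ L)
    (hyh : ∀ s, ‖y s‖ ≤ L * ‖h s‖) {T : ℝ} (hT : 0 ≤ T)
    (heq : ∀ t ∈ Icc 0 T, ∫ x, h (t - x) ∂N = ∫ s in (0 : ℝ)..t, y s) :
    ∀ t ∈ Icc 0 T, h t = 0 := by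
  obtain ⟨k, hk, hq⟩ : ∃ k : ℝ, 0 < k ∧ L * (laplace U k).toReal < 1 := by
    have hlim := ((ENNReal.tendsto_toReal ENNReal.zero_ne_top).comp
      (tendsto_laplace_atTop (hU 1 one_pos) hU0)).const_mul L
    simp only [ENNReal.toReal_zero, mul_zero] at hlim
    obtain ⟨n, hn⟩ := (hlim.eventually_lt_const one_pos).exists
    exact ⟨n + 1, by positivity, hn⟩
  set Λ : ℝ := (laplace U k).toReal with hΛ
  have hΛ0 : 0 ≤ Λ := ENNReal.toReal_nonneg
  have hintΛ : Integrable (fun x => Real.exp (-(k * x))) U :=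
    integrable_exp_of_laplace_ne_top (hU k hk)
  have hΛeq : ∫ x, Real.exp (-(k * x)) ∂U = Λ := by
    rw [hΛ, laplace, integral_eq_lintegral_of_nonneg_ae
      (ae_of_all _ fun x => (Real.exp_pos _).le) (by fun_prop)]
  obtain ⟨s₀, hs₀, hmax⟩ := (isCompact_Icc (a := 0) (b := T)).exists_isMaxOn
    (nonempty_Icc.2 hT) (f := fun s => Real.exp (-(k * s)) * ‖h s‖) (by fun_prop)
  set M : ℝ := Real.exp (-(k * s₀)) * ‖h s₀‖ with hM
  have hM0 : 0 ≤ M := by positivity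
  have hhM (s : ℝ) (hs : s ≤ T) : ‖h s‖ ≤ M * Real.exp (k * s) := by
    rcases le_total s 0 with h0 | h0
    · rw [hh s h0, norm_zero]; positivity
    · have : Real.exp (-(k * s)) * ‖h s‖ ≤ M := hmax ⟨h0, hs⟩
      rw [Real.exp_neg, inv_mul_le_iff₀ (Real.exp_pos _)] at this
      linarith
  have hw (s : ℝ) (hs : s ≤ T) : ‖∫ x, y (s - x) ∂U‖ ≤ L * Λ * M * Real.exp (k * s) := by
    have hb : ∀ᵐ x ∂U, ‖y (s - x)‖ ≤ L * M * Real.exp (k * s) * Real.exp (-(k * x)) := by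
      filter_upwards [ae_pos_of_measure_Iic_zero hU0] with x hx
      refine (hyh _).trans ?_
      calc L * ‖h (s - x)‖ ≤ L * (M * Real.exp (k * (s - x))) :=
            mul_le_mul_of_nonneg_left (hhM _ (by linarith)) hL
        _ = L * M * Real.exp (k * s) * Real.exp (-(k * x)) := by
            rw [mul_sub, sub_eq_add_neg, Real.exp_add]; ring
    refine (norm_integral_le_of_norm_le (hintΛ.const_mul _) hb).trans_eq ?_
    rw [integral_const_mul, hΛeq]
    ring
  have hMle : M ≤ L * Λ * M := by
    rcases hs₀.1.eq_or_lt with h0 | h0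
    · have : M = 0 := by rw [hM, hh s₀ h0.symm.le, norm_zero, mul_zero]
      simp [this]
    · have hwm : StronglyMeasurable fun s => ∫ x, y (s - x) ∂U :=
        (hy.comp_measurable (g := fun p : ℝ × ℝ => p.1 - p.2)
          (by fun_prop)).integral_prod_right'
      have hwle (s : ℝ) (hs : s ≤ s₀) :
          ‖∫ x, y (s - x) ∂U‖ ≤ L * Λ * M * Real.exp (k * s₀) := by
        refine (hw s (hs.trans hs₀.2)).trans (mul_le_mul_of_nonneg_left ?_ (by positivity))
        exact Real.exp_le_exp.2 (mul_le_mul_of_nonneg_left hs hk.le)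
      have hwi (a b : ℝ) (ha : a ≤ s₀) (hb : b ≤ s₀) :
          IntervalIntegrable (fun s => ∫ x, y (s - x) ∂U) volume a b := by
        refine (intervalIntegrable_const (c := L * Λ * M * Real.exp (k * s₀))).mono_fun'
          hwm.aestronglyMeasurable ?_
        filter_upwards [ae_restrict_mem measurableSet_uIoc] with s hs
        exact hwle s (hs.2.trans (max_le ha hb))
      have hfin : ‖h s₀‖ ≤ L * Λ * M * Real.exp (k * s₀) := by
        refine norm_le_of_norm_integral_le hc h0 fun r hr => ?_
        have key (t : ℝ) (ht : t ∈ Icc 0 T) :=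
          integral_eq_integral_conv hU0 (hU 1 one_pos) hN0 hUN hc hh hy hL hyh heq ht
        rw [← intervalIntegral.integral_interval_sub_left (hc.intervalIntegrable 0 s₀)
            (hc.intervalIntegrable 0 r), key s₀ hs₀, key r ⟨hr.1.le, hr.2.le.trans hs₀.2⟩,
          intervalIntegral.integral_interval_sub_left (hwi _ _ h0.le le_rfl)
            (hwi _ _ h0.le hr.2.le)]
        refine (intervalIntegral.norm_integral_le_of_norm_le_const fun s hs => hwle s ?_).trans_eq
          (by rw [abs_of_pos (sub_pos.2 hr.2)])
        rw [uIoc_of_le hr.2.le] at hs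
        exact hs.2
      rw [hM, Real.exp_neg, inv_mul_le_iff₀ (Real.exp_pos _), ← Real.exp_neg, ← hM]
      linarith
  have hMzero : M = 0 := by nlinarith
  intro t ht
  simpa [hMzero] using hhM t ht.2

end HalfLine

/-! ### The Cauchy problem as a Volterra equation -/

section Cauchy

variable {E : Type*} [NormedAddCommGroup E]

/-- The increment `f s - f 0`, extended by `0` to `s < 0`. -/
noncomputable def incrementExt (f : ℝ → E) (s : ℝ) : E := f (max s 0) - f 0

lemma incrementExt_of_nonpos (f : ℝ → E) {s : ℝ} (hs : s ≤ 0) : incrementExt f s = 0 := by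
  simp [incrementExt, max_eq_right hs]

lemma incrementExt_of_nonneg (f : ℝ → E) {s : ℝ} (hs : 0 ≤ s) :
    incrementExt f s = f s - f 0 := by
  simp [incrementExt, max_eq_left hs]

lemma continuous_incrementExt {f : ℝ → E} (hf : ContinuousOn f (Ici 0)) :
    Continuous (incrementExt f) :=
  (hf.comp_continuous (by fun_prop) fun s => le_max_right s 0).sub continuous_const

variable [NormedSpace ℝ E]

/-- The fundamental theorem of calculus for absolutely continuous functions with values in a Banach
space and with bounded derivative; almost everywhere differentiability is a hypothesis, since it may
fail without the Radon–Nikodym property. -/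
lemma AbsolutelyContinuousOnInterval.eq_integral_of_ae_hasDerivAt [CompleteSpace E]
    {H y : ℝ → E} {T C : ℝ}
    (hT : 0 ≤ T) (hAC : AbsolutelyContinuousOnInterval H 0 T)
    (hd : ∀ᵐ s, s ∈ Ioo 0 T → HasDerivAt H (y s) s) (hy : StronglyMeasurable y)
    (hC : ∀ s, ‖y s‖ ≤ C) (hH : H 0 = 0) {t : ℝ} (ht : t ∈ Icc 0 T) :
    H t = ∫ s in (0 : ℝ)..t, y s := by
  have hyi (a b : ℝ) : IntervalIntegrable y volume a b :=
    (intervalIntegrable_const (c := C)).mono_fun' hy.aestronglyMeasurable (ae_of_all _ hC)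
  have hC0 : 0 ≤ C := (norm_nonneg _).trans (hC 0)
  have hK : AbsolutelyContinuousOnInterval (fun t => ∫ s in (0 : ℝ)..t, y s) 0 T := by
    refine LipschitzOnWith.absolutelyContinuousOnInterval (K := C.toNNReal)
      (LipschitzOnWith.of_dist_le_mul fun a _ b _ => ?_)
    rw [dist_eq_norm, intervalIntegral.integral_interval_sub_left (hyi _ _) (hyi _ _),
      Real.coe_toNNReal _ hC0, Real.dist_eq]
    exact intervalIntegral.norm_integral_le_of_norm_le_const fun s _ => hC s
  obtain ⟨c, hc⟩ := (hAC.sub hK).const_of_ae_hasDerivAt_zero (by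
    have h0 : ∀ᵐ s : ℝ, s ≠ 0 := by simp [ae_iff]
    have hT' : ∀ᵐ s : ℝ, s ≠ T := by simp [ae_iff]
    filter_upwards [hd, (hyi 0 T).ae_hasDerivAt_integral, h0, hT'] with s hs₁ hs₂ hs0 hsT hs
    have hs' := hs
    rw [uIcc_of_le hT] at hs'
    rw [← sub_self (y s)]
    exact (hs₁ ⟨lt_of_le_of_ne hs'.1 hs0.symm, lt_of_le_of_ne hs'.2 hsT⟩).sub
      (hs₂ hs 0 left_mem_uIcc))
  rw [uIcc_of_le hT] at hc
  have h0 := hc 0 (left_mem_Icc.2 hT)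
  have ht' := hc t ht
  rw [← h0] at ht'
  simpa [hH, sub_eq_zero] using ht'

lemma caputoConv_eq_integral_tailMeasure {ν : Measure ℝ} (hν : laplace (tailMeasure ν) 1 ≠ ∞)
    (f : ℝ → E) {t : ℝ} (ht : 0 ≤ t) :
    caputoConv ν f t = ∫ x, incrementExt f (t - x) ∂tailMeasure ν := by
  rw [tailMeasure, integral_withDensity_eq_integral_toReal_smul (measurable_measure_Ioi ν)
    (ae_measure_Ioi_lt_top hν), setIntegral_Ioi_smul_comp_sub
    (fun s hs => incrementExt_of_nonpos f hs) (fun x => (ν (Ioi x)).toReal) ht]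
  refine intervalIntegral.integral_congr fun s hs => ?_
  rw [uIcc_of_le ht] at hs
  simp only [levyTail, incrementExt_of_nonneg f hs.1]

/-- Two solutions with the same initial value agree on `[0,T]`, whenever some measure `U` on `(0,∞)`
convolves with the tail measure of `ν` to Lebesgue measure. -/
theorem IsGlobalSolution.eqOn_Icc [CompleteSpace E] {ν U : Measure ℝ} [SFinite U]
    (hν : laplace (tailMeasure ν) 1 ≠ ∞) (hU0 : U (Iic 0) = 0)
    (hU : ∀ z, 0 < z → laplace U z ≠ ∞)
    (hUN : U ∗ tailMeasure ν = volume.restrict (Ioi 0))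
    {F : ℝ → E → E} (hF : LocLipschitzOnBalls F) {f₀ : E} {f g : ℝ → E}
    (hf : IsGlobalSolution ν F f₀ f) (hg : IsGlobalSolution ν F f₀ g) {T : ℝ} (hT : 0 < T) :
    EqOn f g (Icc 0 T) := by
  have hIcc : Icc 0 T ⊆ Ici 0 := Icc_subset_Ici_self
  obtain ⟨R, hR, hfR, hgR⟩ : ∃ R, 0 < R ∧ (∀ s ∈ Icc 0 T, f s ∈ Metric.ball 0 R) ∧
      ∀ s ∈ Icc 0 T, g s ∈ Metric.ball 0 R := by
    obtain ⟨A, hA⟩ := isCompact_Icc.exists_bound_of_continuousOn (hf.continuousOn.mono hIcc)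
    obtain ⟨B, hB⟩ := isCompact_Icc.exists_bound_of_continuousOn (hg.continuousOn.mono hIcc)
    have hA0 := (norm_nonneg _).trans (hA 0 (left_mem_Icc.2 hT.le))
    have hB0 := (norm_nonneg _).trans (hB 0 (left_mem_Icc.2 hT.le))
    refine ⟨A + B + 1, by positivity, fun s hs => ?_, fun s hs => ?_⟩
    · rw [mem_ball_zero_iff]; linarith [hA s hs]
    · rw [mem_ball_zero_iff]; linarith [hB s hs]
  obtain ⟨L, hL, hLip⟩ := hF T hT R hR
  set h : ℝ → E := fun s => incrementExt f s - incrementExt g s with hh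
  have hcf := continuous_incrementExt hf.continuousOn
  have hcg := continuous_incrementExt hg.continuousOn
  have hc : Continuous h := hcf.sub hcg
  have hh0 (s : ℝ) (hs : s ≤ 0) : h s = 0 := by
    simp [hh, incrementExt_of_nonpos _ hs]
  have hhfg (s : ℝ) (hs : 0 ≤ s) : h s = f s - g s := by
    simp [hh, incrementExt_of_nonneg _ hs, hf.initial, hg.initial]
  set H : ℝ → E := fun t => caputoConv ν f t - caputoConv ν g t with hH
  -- Cutting off `deriv H` where it violates the Lipschitz bound changes it on a null set only, and
  -- makes the bound hold everywhere.
  let S : Set ℝ := Ioo 0 T ∩ {s | ‖deriv H s‖ ≤ L * ‖h s‖}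
  let y : ℝ → E := S.indicator (deriv H)
  have hdm : StronglyMeasurable (deriv H) := stronglyMeasurable_deriv H
  have hSm : MeasurableSet S :=
    measurableSet_Ioo.inter
      (measurableSet_le hdm.norm.measurable (continuous_const.mul hc.norm).measurable)
  have hy : StronglyMeasurable y := hdm.indicator hSm
  have hyh (s : ℝ) : ‖y s‖ ≤ L * ‖h s‖ := by
    by_cases hs : s ∈ S
    · simp only [y, indicator_of_mem hs]
      exact hs.2
    · simp only [y, indicator_of_notMem hs, norm_zero]; positivity
  have hd : ∀ᵐ s, s ∈ Ioo 0 T → HasDerivAt H (y s) s := by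
    have h₁ := (ae_restrict_iff' measurableSet_Ioi).1 hf.equation.hasDerivAt
    have h₂ := (ae_restrict_iff' measurableSet_Ioi).1 hg.equation.hasDerivAt
    have h₃ := (ae_restrict_iff' measurableSet_Icc).1 hLip
    filter_upwards [h₁, h₂, h₃] with s hs₁ hs₂ hs₃ hs
    have hsI : s ∈ Icc 0 T := Ioo_subset_Icc_self hs
    have hder : HasDerivAt H (F s (f s) - F s (g s)) s := (hs₁ hs.1).sub (hs₂ hs.1)
    have hsS : s ∈ S := by
      refine ⟨hs, ?_⟩
      change ‖deriv H s‖ ≤ _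
      rw [hder.deriv, hhfg s hs.1.le]
      exact hs₃ hsI _ (hfR s hsI) _ (hgR s hsI)
    simp only [y, indicator_of_mem hsS]
    exact hder.differentiableAt.hasDerivAt
  obtain ⟨C, hC0, hC⟩ := exists_bound_of_continuous_of_eq_zero hc hh0 T
  have hyC (s : ℝ) : ‖y s‖ ≤ L * C := by
    by_cases hs : s ∈ S
    · exact (hyh s).trans (mul_le_mul_of_nonneg_left (hC s hs.1.2.le) hL.le)
    · simp only [y, indicator_of_notMem hs, norm_zero]; positivity
  have hAC : AbsolutelyContinuousOnInterval H 0 T :=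
    (hf.equation.absolutelyContinuous T hT).sub (hg.equation.absolutelyContinuous T hT)
  have hH0 : H 0 = 0 := by simp [hH, caputoConv]
  have hint {e : ℝ → E} (he : Continuous (incrementExt e)) (t : ℝ) :
      Integrable (fun x => incrementExt e (t - x)) (tailMeasure ν) := by
    obtain ⟨C, -, hC⟩ :=
      exists_bound_of_continuous_of_eq_zero he (fun s => incrementExt_of_nonpos e) t
    exact integrable_comp_sub_left_of_bounded (tailMeasure_Iic_zero ν)
      (measure_Iic_ne_top_of_laplace hν t) he.stronglyMeasurable
      (fun s => incrementExt_of_nonpos e) hC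
  have heq (t : ℝ) (ht : t ∈ Icc 0 T) :
      ∫ x, h (t - x) ∂tailMeasure ν = ∫ s in (0 : ℝ)..t, y s := by
    rw [← hAC.eq_integral_of_ae_hasDerivAt hT.le hd hy hyC hH0 ht, hH]
    simp only [caputoConv_eq_integral_tailMeasure hν _ ht.1]
    rw [← integral_sub (hint hcf t) (hint hcg t)]
  intro t ht
  have := eq_zero_of_integral_conv_eq hU0 hU (tailMeasure_Iic_zero ν) hUN hc hh0 hy hL.le hyh hT.le
    heq t ht
  rw [hhfg t ht.1] at this
  exact sub_eq_zero.1 this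

end Cauchy

theorem mainTheorem5 {X : Type*} [NormedAddCommGroup X] [NormedSpace ℝ X] [CompleteSpace X]
    {Ω : Type*} [MeasurableSpace Ω] (P : Measure Ω) [IsProbabilityMeasure P]
    (Φ : ℝ → ℝ) (a b : ℝ) (ν : Measure ℝ) (σ : ℝ≥0 → Ω → ℝ) (u : ℝ → ℝ)
    (hν : IsLevyTriplet Φ a b ν)
    (hσ : IsSubordinator P σ) (hσΦ : HasLaplaceExponent P σ Φ)
    (hu : IsPotentialDensity P σ u)
    (hΦ : StandingAssumption Φ a b ν u)
    (hac : ν ≪ volume)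
    (f₀ : X) (F : ℝ → X → X) (hF : LocLipschitzOnBalls F)
    (f g : ℝ → X) (hf : IsGlobalSolution ν F f₀ f) (hg : IsGlobalSolution ν F f₀ g) :
    EqOn f g (Ici 0) := by
  obtain rfl := hΦ.a_eq
  obtain rfl := hΦ.b_eq
  have hpos := hΦ.special.pos
  obtain ⟨U, hUs, hUP, hUL⟩ := exists_measure_eq_potentialMeasure hσ hσΦ hpos
  have hU0 : U (Iic 0) = 0 := by
    rw [hUP _ measurableSet_Iic, hu.potentialMeasure_Iic_zero]
  have hU (z : ℝ) (hz : 0 < z) : laplace U z ≠ ∞ := by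
    rw [hUL z hz]; exact ENNReal.ofReal_ne_top
  have hN : laplace (tailMeasure ν) 1 ≠ ∞ := by
    rw [laplace_tailMeasure hν hpos one_pos]; exact ENNReal.ofReal_ne_top
  intro t ht
  exact hf.eqOn_Icc hN hU0 hU (conv_tailMeasure_eq_volume hν hpos hUL) hF hg
    (T := t + 1) (by linarith [mem_Ici.1 ht]) ⟨ht, by linarith⟩
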